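/- Let $G$ be a compact Lie group, not necessarily connected (equivalently, a possibly disconnected compact reductive group). Let $T \subseteq G$ be a maximal torus, i.e. a subgroup that is isomorphic as a topological group to $(S^1)^k$ for some $k \ge 0$ and is maximal among such subgroups, and let $N_G(T)$ be its normalizer in $G$. Let $G$ act on $n$-tuples ($n \ge 0$) by simultaneous conjugation, $g(t_1,\dots,t_n)g^{-1} := (g t_1 g^{-1}, \dots, g t_n g^{-1})$. Then for every $(t_1,\dots,t_n) \in T^n$, the intersection of the $G$-orbit of $(t_1,\dots,t_n)$ with $T^n$ is exactly the $N_G(T)$-orbit of $(t_1,\dots,t_n)$. In other words, if $g \in G$ and $g(t_1,\dots,t_n)g^{-1} = (t_1',\dots,t_n') \in T^n$, then there is some $g' \in N_G(T)$ with $g'(t_1,\dots,t_n)g'^{-1} = (t_1',\dots,t_n')$. -/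

import Mathlib

open scoped Manifold ContDiff

/-- A torus in a topological group `G`: a subgroup which, with the subspace topology, is isomorphic
as a topological group to a finite product of circles `(S¹)ᵏ`, `k ≥ 0`. -/
def IsTorus {G : Type*} [Group G] [TopologicalSpace G] (T : Subgroup G) : Prop :=
  ∃ k : ℕ, Nonempty (T ≃ₜ* (Fin k → Circle))

/-- A maximal torus: a torus that is not properly contained in another torus of `G`. -/
def IsMaximalTorus {G : Type*} [Group G] [TopologicalSpace G] (T : Subgroup G) : Prop :=
  Maximal IsTorus T

/-- Simultaneous conjugation `g (t₁, …, tₙ) g⁻¹ = (g t₁ g⁻¹, …, g tₙ g⁻¹)`. -/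
def conjTuple {G : Type*} [Group G] {n : ℕ} (g : G) (t : Fin n → G) : Fin n → G :=
  fun i => g * t i * g⁻¹

/-- The orbit of an `n`-tuple of elements of `G` under simultaneous conjugation by the elements
of a subgroup `H` of `G`. -/
def conjOrbit {G : Type*} [Group G] {n : ℕ} (H : Subgroup G) (t : Fin n → G) : Set (Fin n → G) :=
  {t' | ∃ h ∈ H, conjTuple h t = t'}

/-- The set `Tⁿ` of `n`-tuples of elements of `G` whose entries all lie in `T`. -/
def tuplesIn {G : Type*} [Group G] (n : ℕ) (T : Subgroup G) : Set (Fin n → G) :=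
  {t | ∀ i, t i ∈ T}

/-!
If `g` carries `t ∈ Tⁿ` into `Tⁿ`, then `T` and `g⁻¹ T g` are both tori in the centralizer `Z` of
`t`, a compact group. Maximal tori being conjugate in `Z`, there is `z ∈ Z` with
`z T z⁻¹ = g⁻¹ T g`, and `g z` normalizes `T` and moves `t` exactly as `g` does. So everything
rests on a conjugacy theorem for maximal tori, which is proved here for all compact Hausdorff
groups, connected or not.

Two observations about tori reduce it to one-parameter subgroups. A torus has a dense
one-parameter subgroup (`exists_denseRange_oneParameter`), and two commuting tori lie in a common
torus, because a Hausdorff quotient of a torus is a torus (`isTorus_range_of_continuous`). Both come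
from the structure of closed subgroups of `ℝᵏ` (`AddSubgroup.exists_linearMap_mem_iff_int`). Hence
it suffices to conjugate one of two given one-parameter subgroups `x`, `y` of `Z` so that it commutes
with the other; maximality then forces the tori to be equal.

In a finite-dimensional orthogonal representation this is Hunt's variational argument
(`exists_conj_commute_of_finiteDimensional`). Let `X`, `Y` be the generators of `x`, `y` there, and
choose `z ∈ Z` maximizing `tr (z X z⁻¹ Y)`; replace `X` by `z X z⁻¹`. For fixed `b`, the function
`a ↦ tr (e^{bY} X e^{-bY} e^{-aX} Y e^{aX})` has its maximum at `a = 0`, so its derivative there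
vanishes; differentiating the resulting identity in `b` at `0` gives `tr [X, Y]² = 0`. As `[X, Y]` is
skew-symmetric, it is `0`.

The passage to `Z` itself is a compactness argument (`exists_conj_commute`): by the Peter–Weyl
theorem (`topologicalClosure_finiteDimensionalPart`), the finite-dimensional invariant subspaces
span a dense subspace of `L²(Z)`, on which `Z` acts faithfully. The conjugators that work on a given
invariant subspace form a nonempty closed set, and these sets are directed.
-/

/-! ### Closed subgroups of finite-dimensional real vector spaces -/

open Filter Topology in
/-- A closed subgroup of a finite-dimensional space that contains no line is discrete: otherwise
the integer multiples of ever shorter elements accumulate on a whole line. -/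
theorem AddSubgroup.discreteTopology_of_forall_line {W : Type*} [NormedAddCommGroup W]
    [NormedSpace ℝ W] [FiniteDimensional ℝ W] (N : AddSubgroup W) (hN : IsClosed (N : Set W))
    (hline : ∀ w : W, (∀ s : ℝ, s • w ∈ N) → w = 0) : DiscreteTopology N := by
  have key : ∃ ε > 0, ∀ x ∈ N, ‖x‖ < ε → x = 0 := by
    by_contra! hcon
    choose x hxN hxlt hx0 using fun j : ℕ ↦ hcon (1 / ((j : ℝ) + 1)) Nat.one_div_pos_of_nat
    have hxlim : Tendsto (fun j ↦ ‖x j‖) atTop (𝓝 0) :=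
      squeeze_zero (fun j ↦ norm_nonneg _) (fun j ↦ (hxlt j).le)
        tendsto_one_div_add_atTop_nhds_zero_nat
    have hpos : ∀ j, 0 < ‖x j‖ := fun j ↦ norm_pos_iff.2 (hx0 j)
    have hu : ∀ j, ‖x j‖⁻¹ • x j ∈ Metric.sphere (0 : W) 1 := fun j ↦ by
      simp [norm_smul, (hpos j).ne']
    obtain ⟨u, hu1, φ, hφ, hlim⟩ := (isCompact_sphere (0 : W) 1).tendsto_subseq hu
    have hu0 : u = 0 := by
      refine hline u fun s ↦ ?_
      -- integer multiples of `x (φ j)` within `‖x (φ j)‖` of `s • u`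
      have hmem : ∀ j, ⌊s / ‖x (φ j)‖⌋ • x (φ j) ∈ (N : Set W) := fun j ↦
        N.zsmul_mem (hxN _) _
      have h1 : Tendsto (fun j ↦ s • (‖x (φ j)‖⁻¹ • x (φ j))) atTop (𝓝 (s • u)) :=
        hlim.const_smul s
      have h2 : Tendsto (fun j ↦ ⌊s / ‖x (φ j)‖⌋ • x (φ j) - s • (‖x (φ j)‖⁻¹ • x (φ j)))
          atTop (𝓝 0) := by
        refine squeeze_zero_norm (fun j ↦ ?_) (hxlim.comp hφ.tendsto_atTop)
        rw [← Int.cast_smul_eq_zsmul ℝ, smul_smul, ← sub_smul, norm_smul]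
        refine mul_le_of_le_one_left (norm_nonneg _) ?_
        rw [← div_eq_mul_inv, Real.norm_eq_abs, abs_le]
        constructor <;>
          linarith [Int.lt_floor_add_one (s / ‖x (φ j)‖), Int.floor_le (s / ‖x (φ j)‖)]
      exact hN.mem_of_tendsto (by simpa using h2.add h1) (Eventually.of_forall hmem)
    rw [hu0] at hu1
    simp at hu1
  obtain ⟨ε, hε, h⟩ := key
  refine discreteTopology_of_isOpen_singleton_zero ?_
  rw [Metric.isOpen_iff]
  rintro x rfl
  refine ⟨ε, hε, fun y hy ↦ ?_⟩
  rw [Set.mem_singleton_iff]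
  exact Subtype.ext (h y y.2 (by simpa using hy))

/-- A closed spanning subgroup `N` of a finite-dimensional space is the preimage of `ℤᵏ` under
a linear surjection onto `ℝᵏ`. The kernel `V₀` of that map is the largest subspace inside `N`; on a
complement `W` of `V₀` the subgroup is a lattice, and a lattice basis gives the coordinates. -/
theorem AddSubgroup.exists_linearMap_mem_iff_int {V : Type*} [NormedAddCommGroup V]
    [NormedSpace ℝ V] [FiniteDimensional ℝ V] (N : AddSubgroup V) (hN : IsClosed (N : Set V))
    (hspan : Submodule.span ℝ (N : Set V) = ⊤) :
    ∃ (k : ℕ) (l : V →ₗ[ℝ] (Fin k → ℝ)), Function.Surjective l ∧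
      ∀ v, v ∈ N ↔ ∀ i, ∃ m : ℤ, l v i = m := by
  let V₀ : Submodule ℝ V :=
    { carrier := {v | ∀ s : ℝ, s • v ∈ N}
      add_mem' := fun ha hb s ↦ by rw [smul_add]; exact N.add_mem (ha s) (hb s)
      zero_mem' := fun s ↦ by rw [smul_zero]; exact N.zero_mem
      smul_mem' := fun c v hv s ↦ by rw [smul_smul]; exact hv _ }
  have hV₀ : ∀ v ∈ V₀, v ∈ N := fun v hv ↦ by simpa using hv 1
  obtain ⟨W, hW⟩ := V₀.exists_isCompl
  let π : V →ₗ[ℝ] W := W.projectionOnto V₀ hW.symm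
  have hπsub : ∀ v, v - π v ∈ V₀ := fun v ↦ by
    rw [← Submodule.projectionOnto_apply_eq_zero_iff hW.symm, map_sub,
      Submodule.projectionOnto_apply_left, sub_self]
  have hmem : ∀ v, v ∈ N ↔ (π v : V) ∈ N := fun v ↦ by
    conv_lhs => rw [← sub_add_cancel v (π v)]
    exact N.add_mem_cancel_left (hV₀ _ (hπsub v))
  let L : Submodule ℤ W := AddSubgroup.toIntSubmodule (N.comap W.subtype.toAddMonoidHom)
  have hLmem : ∀ w : W, w ∈ L ↔ (w : V) ∈ N := fun w ↦ Iff.rfl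
  have : DiscreteTopology L := by
    refine AddSubgroup.discreteTopology_of_forall_line (N.comap W.subtype.toAddMonoidHom)
      (hN.preimage continuous_subtype_val) fun w hw ↦ ?_
    have : (w : V) ∈ V₀ := fun s ↦ hw s
    exact Subtype.ext (Submodule.disjoint_def.1 hW.disjoint _ this w.2)
  have : IsZLattice ℝ L := ⟨by
    rw [eq_top_iff]
    have hsurj : Submodule.map π ⊤ = ⊤ := by
      rw [Submodule.map_top, LinearMap.range_eq_top]; exact Submodule.projectionOnto_surjective _
    rw [← hsurj, ← hspan, Submodule.map_span]
    refine Submodule.span_mono ?_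
    rintro _ ⟨v, hv, rfl⟩
    exact (hmem v).1 hv⟩
  have : Module.Free ℤ L := ZLattice.module_free ℝ L
  have : Module.Finite ℤ L := ZLattice.module_finite ℝ L
  let b := Module.finBasis ℤ L
  let B := b.ofZLatticeBasis ℝ L
  refine ⟨_, B.equivFun.toLinearMap ∘ₗ π, ?_, fun v ↦ ?_⟩
  · exact B.equivFun.surjective.comp (Submodule.projectionOnto_surjective _)
  · have hB : π v ∈ Submodule.span ℤ (Set.range B) ↔ π v ∈ L := by
      rw [b.ofZLatticeBasis_span ℝ]
    rw [hmem, ← hLmem, ← hB, Module.Basis.mem_span_iff_repr_mem]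
    simp [eq_comm]

/-! ### Tori: dense one-parameter subgroups and quotients -/

open Real in
/-- The covering `ℝᵏ → (S¹)ᵏ`, `v ↦ (exp (2πi v₁), …, exp (2πi vₖ))`. -/
noncomputable def torusCover (k : ℕ) (v : Fin k → ℝ) : Fin k → Circle :=
  fun i ↦ Circle.exp (2 * π * v i)

theorem continuous_torusCover (k : ℕ) : Continuous (torusCover k) := by
  unfold torusCover; fun_prop

theorem torusCover_add {k : ℕ} (v w : Fin k → ℝ) :
    torusCover k (v + w) = torusCover k v * torusCover k w := by
  ext i; simp [torusCover, mul_add, Circle.exp_add]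

theorem torusCover_eq_one_iff {k : ℕ} (v : Fin k → ℝ) :
    torusCover k v = 1 ↔ ∀ i, ∃ m : ℤ, v i = m := by
  rw [funext_iff]
  refine forall_congr' fun i ↦ ?_
  rw [torusCover, Pi.one_apply, Circle.exp_eq_one]
  refine exists_congr fun m ↦ ?_
  rw [mul_comm]
  exact mul_left_inj' Real.two_pi_pos.ne'

/-- Every point of `(S¹)ᵏ` is covered by a point of the compact unit cube. -/
theorem exists_torusCover_eq {k : ℕ} (z : Fin k → Circle) :
    ∃ v ∈ Set.Icc (0 : Fin k → ℝ) 1, torusCover k v = z := by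
  choose r hr using fun i ↦ Circle.exp_surjective (z i)
  refine ⟨fun i ↦ Int.fract (r i / (2 * Real.pi)), ⟨fun i ↦ Int.fract_nonneg _,
    fun i ↦ (Int.fract_lt_one _).le⟩, ?_⟩
  funext i
  rw [torusCover, ← hr i, Circle.exp_eq_exp]
  refine ⟨-⌊r i / (2 * Real.pi)⌋, ?_⟩
  rw [Int.fract, mul_sub, mul_div_cancel₀ _ Real.two_pi_pos.ne']
  push_cast; ring

/-- The covering `ℝᵏ → (S¹)ᵏ` as a homomorphism of additive groups. -/
noncomputable def torusCoverHom (k : ℕ) : (Fin k → ℝ) →+ Additive (Fin k → Circle) where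
  toFun v := Additive.ofMul (torusCover k v)
  map_zero' := by
    rw [← ofMul_one]; exact congrArg _ ((torusCover_eq_one_iff _).2 fun i ↦ ⟨0, by simp⟩)
  map_add' v w := by rw [torusCover_add, ofMul_mul]

theorem span_eq_top_of_int_mem {k : ℕ} (N : AddSubgroup (Fin k → ℝ))
    (h : ∀ v : Fin k → ℝ, (∀ i, ∃ m : ℤ, v i = m) → v ∈ N) :
    Submodule.span ℝ (N : Set (Fin k → ℝ)) = ⊤ := by
  rw [eq_top_iff, ← (Pi.basisFun ℝ (Fin k)).span_eq]
  refine Submodule.span_mono ?_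
  rintro _ ⟨i, rfl⟩
  refine h _ fun j ↦ ?_
  by_cases hij : j = i
  · subst hij; exact ⟨1, by simp⟩
  · exact ⟨0, by simp [hij]⟩

theorem exists_linearIndependent_rat_real (k : ℕ) :
    ∃ α : Fin k → ℝ, LinearIndependent ℚ α := by
  have h : (k : Cardinal) ≤ Module.rank ℚ ℝ := by
    rw [Real.rank_rat_real]; exact Cardinal.nat_lt_continuum k |>.le
  obtain ⟨f, hf⟩ := Module.le_rank_iff_exists_linearMap.1 h
  exact ⟨_, (Pi.basisFun ℚ (Fin k)).linearIndependent.map' f (LinearMap.ker_eq_bot.2 hf)⟩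

/-- Kronecker's theorem: every torus has a dense one-parameter subgroup. If `α` has rationally
independent coordinates, no nonzero integral functional vanishes on `α`, so the closed subgroup of
`ℝᵏ` over the closure of the line `ℝ α` is all of `ℝᵏ`. -/
theorem exists_denseRange_oneParameter (k : ℕ) :
    ∃ α : Fin k → ℝ, DenseRange fun s : ℝ ↦ torusCover k (s • α) := by
  obtain ⟨α, hα⟩ := exists_linearIndependent_rat_real k
  refine ⟨α, ?_⟩
  let R : Subgroup (Fin k → Circle) :=
    { carrier := Set.range fun s : ℝ ↦ torusCover k (s • α)
      mul_mem' := by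
        rintro _ _ ⟨s, rfl⟩ ⟨t, rfl⟩
        exact ⟨s + t, by simp only [add_smul, torusCover_add]⟩
      one_mem' := ⟨0, (torusCover_eq_one_iff _).2 fun i ↦ ⟨0, by simp⟩⟩
      inv_mem' := by
        rintro _ ⟨s, rfl⟩
        refine ⟨-s, eq_inv_of_mul_eq_one_left ?_⟩
        rw [← torusCover_add, ← add_smul]
        exact (torusCover_eq_one_iff _).2 fun i ↦ ⟨0, by simp⟩ }
  let C := R.topologicalClosure
  let N : AddSubgroup (Fin k → ℝ) := (Subgroup.toAddSubgroup C).comap (torusCoverHom k)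
  have hNmem : ∀ v, v ∈ N ↔ torusCover k v ∈ C := fun v ↦ Iff.rfl
  have hN : IsClosed (N : Set (Fin k → ℝ)) :=
    R.isClosed_topologicalClosure.preimage (continuous_torusCover k)
  have hint : ∀ v : Fin k → ℝ, (∀ i, ∃ m : ℤ, v i = m) → v ∈ N := fun v hv ↦ by
    rw [hNmem, (torusCover_eq_one_iff v).2 hv]; exact C.one_mem
  obtain ⟨d, l, hl, hlN⟩ := N.exists_linearMap_mem_iff_int hN (span_eq_top_of_int_mem N hint)
  have hd : IsEmpty (Fin d) := by
    refine ⟨fun j ↦ ?_⟩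
    -- `f` is a nonzero functional that is integral on `ℤᵏ` and on the line `ℝ α`
    let f : (Fin k → ℝ) →ₗ[ℝ] ℝ := LinearMap.proj j ∘ₗ l
    have hαN : ∀ s : ℝ, ∃ m : ℤ, s * f α = m := fun s ↦ by
      have : s • α ∈ N := R.le_topologicalClosure ⟨s, rfl⟩
      simpa [f] using (hlN _).1 this j
    have hfα : f α = 0 := by
      -- otherwise `f` takes the value `1 / 2` on the line
      by_contra h0
      obtain ⟨m, hm⟩ := hαN ((2 * f α)⁻¹)
      rw [mul_inv, mul_assoc, inv_mul_cancel₀ h0, mul_one] at hm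
      have : (2 : ℝ) * m = 1 := by rw [← hm]; norm_num
      have : (2 : ℤ) * m = 1 := by exact_mod_cast this
      omega
    choose m hm using fun i ↦ (hlN _).1 (hint (Pi.single i 1) fun i' ↦
      ⟨(Pi.single i 1 : Fin k → ℤ) i', by by_cases h : i' = i <;> simp [h]⟩) j
    have hfe : ∀ v, f v = ∑ i, v i * m i := fun v ↦ by
      rw [LinearMap.pi_apply_eq_sum_univ f v]
      refine Finset.sum_congr rfl fun i _ ↦ ?_
      rw [smul_eq_mul, ← hm]
      change _ = v i * f (Pi.single i 1)
      congr 2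
      ext i'
      simp [Pi.single_apply, eq_comm]
    have hm0 : ∀ i, m i = 0 := by
      rw [Fintype.linearIndependent_iff] at hα
      intro i
      have := hα (fun i ↦ (m i : ℚ)) (by
        rw [← hfα, hfe]
        refine Finset.sum_congr rfl fun i _ ↦ ?_
        rw [Rat.smul_def, mul_comm]; simp) i
      exact_mod_cast this
    obtain ⟨v, hv⟩ := hl 1
    have : f v = 1 := congrFun hv j
    simp [hfe, hm0] at this
  intro z
  obtain ⟨v, -, rfl⟩ := exists_torusCover_eq z
  exact (hlN v).2 fun i ↦ hd.elim i

/-- A Hausdorff quotient of a torus is a torus. -/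
theorem isTorus_range_of_continuous {G : Type*} [Group G] [TopologicalSpace G] [T2Space G]
    {m : ℕ} (f : (Fin m → Circle) →* G) (hf : Continuous f) : IsTorus f.range := by
  let φ : (Fin m → ℝ) → f.range := fun v ↦ f.rangeRestrict (torusCover m v)
  have hφc : Continuous φ :=
    (hf.comp (continuous_torusCover m)).subtype_mk _
  have hφadd : ∀ v w, φ (v + w) = φ v * φ w := fun v w ↦ by simp [φ, torusCover_add]
  let N : AddSubgroup (Fin m → ℝ) :=
    (Subgroup.toAddSubgroup f.ker).comap (torusCoverHom m)
  have hNmem : ∀ v, v ∈ N ↔ f (torusCover m v) = 1 := fun v ↦ Iff.rfl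
  have hN : IsClosed (N : Set (Fin m → ℝ)) :=
    isClosed_singleton.preimage (hf.comp (continuous_torusCover m))
  obtain ⟨d, l, hl, hlN⟩ := N.exists_linearMap_mem_iff_int hN
    (span_eq_top_of_int_mem N fun v hv ↦ by
      rw [hNmem, (torusCover_eq_one_iff v).2 hv, map_one])
  let ψ : (Fin m → ℝ) → (Fin d → Circle) := fun v ↦ torusCover d (l v)
  have hψc : Continuous ψ := (continuous_torusCover d).comp l.continuous_of_finiteDimensional
  have hψadd : ∀ v w, ψ (v + w) = ψ v * ψ w := fun v w ↦ by simp [ψ, torusCover_add]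
  have hker : ∀ v, φ v = 1 ↔ ψ v = 1 := fun v ↦ by
    rw [torusCover_eq_one_iff, ← hlN, hNmem, ← Subtype.coe_inj]; rfl
  have hsub : ∀ v w, φ v = φ w ↔ ψ v = ψ w := fun v w ↦ by
    have h1 : φ v = φ (v - w) * φ w := by rw [← hφadd, sub_add_cancel]
    have h2 : ψ v = ψ (v - w) * ψ w := by rw [← hψadd, sub_add_cancel]
    rw [h1, h2, mul_eq_right, mul_eq_right, hker]
  -- the unit cube is compact and maps onto the range of `f`
  have hφs : ∀ x : f.range, ∃ v : Set.Icc (0 : Fin m → ℝ) 1, φ v = x := by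
    rintro ⟨_, z, rfl⟩
    obtain ⟨v, hv, rfl⟩ := exists_torusCover_eq z
    exact ⟨⟨v, hv⟩, rfl⟩
  have hψs : Function.Surjective ψ := fun z ↦ by
    obtain ⟨w, -, rfl⟩ := exists_torusCover_eq z
    obtain ⟨v, rfl⟩ := hl w
    exact ⟨v, rfl⟩
  choose σ hσ using hφs
  have hσψ : ∀ v, ψ (σ (φ v)) = ψ v := fun v ↦ (hsub _ _).1 (hσ _)
  let e : f.range →* (Fin d → Circle) := MonoidHom.mk' (fun x ↦ ψ (σ x)) fun x y ↦ by
    rw [← hψadd, ← hsub, hφadd, hσ, hσ, hσ]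
  have hec : Continuous e := by
    have hq : Topology.IsQuotientMap fun v : Set.Icc (0 : Fin m → ℝ) 1 ↦ φ v :=
      (hφc.comp continuous_subtype_val).isClosedMap.isQuotientMap
        (hφc.comp continuous_subtype_val) fun x ↦ ⟨σ x, hσ x⟩
    rw [hq.continuous_iff]
    exact (hψc.comp continuous_subtype_val).congr fun v ↦ (hσψ v).symm
  have hbij : Function.Bijective e := by
    refine ⟨fun x y hxy ↦ ?_, fun z ↦ ?_⟩
    · rw [← hσ x, ← hσ y]; exact (hsub _ _).2 hxy
    · obtain ⟨v, rfl⟩ := hψs z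
      exact ⟨φ v, hσψ v⟩
  have : CompactSpace f.range := isCompact_iff_compactSpace.1 (isCompact_range hf)
  let E := MulEquiv.ofBijective e hbij
  exact ⟨d, ⟨{ E with
    continuous_toFun := hec
    continuous_invFun := (hec.homeoOfEquivCompactToT2 (f := E.toEquiv)).continuous_invFun }⟩⟩

/-- The subgroup generated by two commuting tori is contained in a torus (in fact is one). -/
theorem IsTorus.exists_isTorus_ge_of_commute {G : Type*} [Group G] [TopologicalSpace G]
    [IsTopologicalGroup G] [T2Space G] {S T : Subgroup G} (hS : IsTorus S) (hT : IsTorus T)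
    (hST : ∀ s ∈ S, ∀ t ∈ T, Commute s t) : ∃ P : Subgroup G, IsTorus P ∧ S ≤ P ∧ T ≤ P := by
  obtain ⟨k, ⟨e⟩⟩ := hS
  obtain ⟨m, ⟨e'⟩⟩ := hT
  let f : (Fin (k + m) → Circle) →* G := MonoidHom.mk'
    (fun z ↦ (e.symm fun i ↦ z (Fin.castAdd m i)) * (e'.symm fun i ↦ z (Fin.natAdd k i)))
    fun z w ↦ by
      have h1 : (fun i ↦ (z * w) (Fin.castAdd m i)) =
        (fun i ↦ z (Fin.castAdd m i)) * fun i ↦ w (Fin.castAdd m i) := rfl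
      have h2 : (fun i ↦ (z * w) (Fin.natAdd k i)) =
        (fun i ↦ z (Fin.natAdd k i)) * fun i ↦ w (Fin.natAdd k i) := rfl
      rw [h1, h2, map_mul, map_mul, Subgroup.coe_mul, Subgroup.coe_mul]
      exact (hST _ (SetLike.coe_mem _) _ (SetLike.coe_mem _)).mul_mul_mul_comm _ _
  have hf : Continuous f := by
    refine Continuous.mul (continuous_subtype_val.comp (e.symm.continuous.comp ?_))
      (continuous_subtype_val.comp (e'.symm.continuous.comp ?_)) <;> fun_prop
  refine ⟨f.range, isTorus_range_of_continuous f hf, fun s hs ↦ ?_, fun t ht ↦ ?_⟩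
  · refine ⟨Fin.append (e ⟨s, hs⟩) 1, ?_⟩
    have : (fun _ ↦ 1 : Fin m → Circle) = 1 := rfl
    simp [f, this]
  · refine ⟨Fin.append 1 (e' ⟨t, ht⟩), ?_⟩
    have : (fun _ ↦ 1 : Fin k → Circle) = 1 := rfl
    simp [f, this]

/-! ### The Peter–Weyl theorem -/

section PeterWeyl

open MeasureTheory InnerProductSpace

theorem continuous_rankOne_self {X H : Type*} [TopologicalSpace X] [NormedAddCommGroup H]
    [InnerProductSpace ℝ H] {f : X → H} (hf : Continuous f) :
    Continuous fun x ↦ rankOne ℝ (f x) (f x) := by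
  simp only [rankOne_def]
  fun_prop

theorem isCompactOperator_rankOne {H : Type*} [NormedAddCommGroup H] [InnerProductSpace ℝ H]
    (x y : H) : IsCompactOperator (rankOne ℝ x y) := by
  rw [rankOne_def']
  exact (isCompactOperator_of_locallyCompactSpace_rng
    (ContinuousLinearMap.toSpanSingleton ℝ x)).comp_clm (innerSL ℝ y)

theorem Continuous.integrable_of_compactSpace {X E : Type*} [TopologicalSpace X] [CompactSpace X]
    [MeasurableSpace X] [BorelSpace X] [NormedAddCommGroup E] {μ : Measure X}
    [IsFiniteMeasure μ] {f : X → E} (hf : Continuous f) : Integrable f μ :=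
  hf.integrable_of_hasCompactSupport (HasCompactSupport.of_compactSpace f)

variable {G : Type*} [Group G] {H : Type*} [NormedAddCommGroup H] [InnerProductSpace ℝ H]

/-- The sum of all finite-dimensional invariant subspaces of an orthogonal representation. -/
def finiteDimensionalPart (π : G →* (H ≃ₗᵢ[ℝ] H)) : Submodule ℝ H :=
  sSup {V | FiniteDimensional ℝ V ∧ ∀ g, ∀ v ∈ V, π g v ∈ V}

theorem inner_map_left (π : G →* (H ≃ₗᵢ[ℝ] H)) (g : G) (v w : H) :
    inner ℝ (π g v) w = inner ℝ v (π g⁻¹ w) := by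
  rw [← (π g⁻¹).inner_map_map, map_inv]
  exact congrArg (inner ℝ · _) ((π g).symm_apply_apply v)

theorem map_mem_finiteDimensionalPart (π : G →* (H ≃ₗᵢ[ℝ] H)) (g : G) {v : H}
    (hv : v ∈ finiteDimensionalPart π) : π g v ∈ finiteDimensionalPart π := by
  suffices finiteDimensionalPart π ≤
      (finiteDimensionalPart π).comap (π g).toLinearEquiv.toLinearMap from this hv
  exact sSup_le fun V hV w hw ↦ (le_sSup hV : V ≤ finiteDimensionalPart π) (hV.2 g w hw)

variable [TopologicalSpace G] [CompactSpace G] [MeasurableSpace G] [BorelSpace G]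

/-- The average over `G` of the rank one operators `w ↦ ⟪π g v, w⟫ • π g v`. -/
noncomputable def orbitOperator (μ : Measure G) (π : G →* (H ≃ₗᵢ[ℝ] H)) (v : H) : H →L[ℝ] H :=
  ∫ g, rankOne ℝ (π g v) (π g v) ∂μ

variable {π : G →* (H ≃ₗᵢ[ℝ] H)}

theorem orbitOperator_apply {μ : Measure G} [IsFiniteMeasure μ]
    (hπ : ∀ v, Continuous fun g ↦ π g v) (v w : H) :
    orbitOperator μ π v w = ∫ g, inner ℝ (π g v) w • π g v ∂μ := by
  rw [orbitOperator, ContinuousLinearMap.integral_apply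
    (continuous_rankOne_self (hπ v)).integrable_of_compactSpace]
  simp

theorem inner_orbitOperator [CompleteSpace H] {μ : Measure G} [IsFiniteMeasure μ]
    (hπ : ∀ v, Continuous fun g ↦ π g v) (v w u : H) :
    inner ℝ u (orbitOperator μ π v w) = ∫ g, inner ℝ (π g v) w * inner ℝ u (π g v) ∂μ := by
  have := hπ v
  rw [orbitOperator_apply hπ, ← integral_inner]
  · simp only [inner_smul_right]
  · exact Continuous.integrable_of_compactSpace (by fun_prop)

theorem isCompactOperator_orbitOperator [CompleteSpace H] {μ : Measure G} [IsProbabilityMeasure μ]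
    (hπ : ∀ v, Continuous fun g ↦ π g v) (v : H) :
    IsCompactOperator (orbitOperator μ π v) := by
  refine ((compactOperator (RingHom.id ℝ) H H).convex (𝕜 := ℝ)).integral_mem
    (μ := μ) (f := fun g ↦ rankOne ℝ (π g v) (π g v))
    isClosed_setOfPred_isCompactOperator (Filter.Eventually.of_forall fun g ↦ ?_)
    (continuous_rankOne_self (hπ v)).integrable_of_compactSpace
  exact isCompactOperator_rankOne _ _

theorem isSymmetric_orbitOperator [CompleteSpace H] {μ : Measure G} [IsFiniteMeasure μ]
    (hπ : ∀ v, Continuous fun g ↦ π g v) (v : H) :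
    (orbitOperator μ π v).IsSymmetric := fun w u ↦ by
  rw [ContinuousLinearMap.coe_coe, real_inner_comm, inner_orbitOperator hπ,
    inner_orbitOperator hπ]
  refine integral_congr_ae (Filter.Eventually.of_forall fun g ↦ ?_)
  simp only [real_inner_comm, mul_comm]

theorem orbitOperator_map [CompleteSpace H] [IsTopologicalGroup G]
    {μ : Measure G} [IsFiniteMeasure μ] [μ.IsMulLeftInvariant]
    (hπ : ∀ v, Continuous fun g ↦ π g v) (v w : H) (h : G) :
    orbitOperator μ π v (π h w) = π h (orbitOperator μ π v w) := by
  have := hπ v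
  rw [orbitOperator_apply hπ, orbitOperator_apply hπ, ← integral_mul_left_eq_self _ h]
  change _ = (π h).toContinuousLinearEquiv.toContinuousLinearMap _
  rw [← ContinuousLinearMap.integral_comp_comm _
    (Continuous.integrable_of_compactSpace (by fun_prop))]
  simp

theorem orbitOperator_ne_zero [CompleteSpace H] {μ : Measure G} [IsFiniteMeasure μ]
    [μ.IsOpenPosMeasure] (hπ : ∀ v, Continuous fun g ↦ π g v) {v : H} (hv : v ≠ 0) :
    orbitOperator μ π v ≠ 0 := fun h0 ↦ by
  have := hπ v
  have hpos : 0 < ∫ g, inner ℝ (π g v) v * inner ℝ v (π g v) ∂μ := by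
    refine Continuous.integral_pos_of_hasCompactSupport_nonneg_nonzero (x := 1) (by fun_prop)
      (HasCompactSupport.of_compactSpace _) (fun g ↦ ?_) ?_
    · simp only [real_inner_comm v]; exact mul_self_nonneg _
    · simpa using hv
  rw [← inner_orbitOperator hπ, h0] at hpos
  simp at hpos

open Module.End in
/-- The Peter–Weyl theorem for orthogonal representations: the finite-dimensional invariant
subspaces span a dense subspace. A nonzero `v` orthogonal to all of them would give a nonzero
compact symmetric operator commuting with `G` whose range is orthogonal to them too, although its
eigenspaces for nonzero eigenvalues are finite-dimensional, invariant and contained in the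
range. -/
theorem topologicalClosure_finiteDimensionalPart [CompleteSpace H] [IsTopologicalGroup G]
    {μ : Measure G} [IsProbabilityMeasure μ] [μ.IsMulLeftInvariant] [μ.IsOpenPosMeasure]
    (hπ : ∀ v, Continuous fun g ↦ π g v) :
    (finiteDimensionalPart π).topologicalClosure = ⊤ := by
  rw [Submodule.topologicalClosure_eq_top_iff, Submodule.eq_bot_iff]
  by_contra! hcon
  obtain ⟨v, hv, hv0⟩ := hcon
  let A := orbitOperator μ π v
  have hAmem : ∀ w, A w ∈ (finiteDimensionalPart π)ᗮ := fun w u hu ↦ by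
    rw [inner_orbitOperator hπ]
    refine integral_eq_zero_of_ae (Filter.Eventually.of_forall fun g ↦ ?_)
    have : inner ℝ u (π g v) = 0 := by
      rw [real_inner_comm, inner_map_left, real_inner_comm]
      exact hv _ (map_mem_finiteDimensionalPart π _ hu)
    simp [this]
  have hAc : IsCompactOperator A := isCompactOperator_orbitOperator hπ v
  have hex : ∃ c : ℝ, HasEigenvalue (A : Module.End ℝ H) c ∧ c ≠ 0 := by
    by_contra! h
    exact orbitOperator_ne_zero hπ hv0
      ((ContinuousLinearMap.eq_zero_of_forall_hasEigenvalue_eq_zero hAc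
        (isSymmetric_orbitOperator hπ v)).1 h)
  obtain ⟨c, hc, hc0⟩ := hex
  have hE : eigenspace (A : Module.End ℝ H) c ≤ finiteDimensionalPart π := by
    refine le_sSup ⟨ContinuousLinearMap.finite_dimensional_eigenspace hAc c hc0, fun g w hw ↦ ?_⟩
    rw [mem_eigenspace_iff] at hw ⊢
    change A (π g w) = _
    rw [orbitOperator_map hπ]
    exact (congrArg (π g) hw).trans (map_smul _ _ _)
  obtain ⟨x, hx, hx0⟩ := hc.exists_hasEigenvector
  have hx1 : x ∈ (finiteDimensionalPart π)ᗮ := by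
    have : A x = c • x := mem_eigenspace_iff.1 hx
    rw [← inv_smul_smul₀ hc0 x, ← this]
    exact Submodule.smul_mem _ _ (hAmem x)
  exact hx0 (inner_self_eq_zero.1 (hx1 x (hE hx)))

end PeterWeyl

open MeasureTheory in
/-- A compact Hausdorff group has a faithful, strongly continuous orthogonal representation, the
left regular one on `L²(G)`. -/
theorem exists_injective_orthogonal_representation (G : Type*) [Group G] [TopologicalSpace G]
    [IsTopologicalGroup G] [CompactSpace G] [T2Space G] [MeasurableSpace G] [BorelSpace G]
    (μ : Measure G) [μ.IsMulLeftInvariant] [μ.IsOpenPosMeasure] [μ.Regular] :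
    ∃ π : G →* (Lp ℝ 2 μ ≃ₗᵢ[ℝ] Lp ℝ 2 μ), Function.Injective π ∧
      ∀ v, Continuous fun g ↦ π g v := by
  let π : G →* (Lp ℝ 2 μ ≃ₗᵢ[ℝ] Lp ℝ 2 μ) :=
    -- `DomMulAct` acts by `(g • f) x = f (g * x)`, whence the inverse
    { toFun := fun g ↦
        { toFun := fun f ↦ DomMulAct.mk g⁻¹ • f
          invFun := fun f ↦ DomMulAct.mk g • f
          map_add' := fun f f' ↦ smul_add _ _ _
          map_smul' := fun c f ↦ smul_comm _ _ _
          left_inv := fun f ↦ by simp [smul_smul]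
          right_inv := fun f ↦ by simp [smul_smul]
          norm_map' := fun f ↦ DomMulAct.norm_smul_Lp _ _ }
      map_one' := by
        ext1 f
        change DomMulAct.mk (1 : G)⁻¹ • f = f
        simp
      map_mul' := fun g h ↦ by
        ext1 f
        change DomMulAct.mk (g * h)⁻¹ • f = DomMulAct.mk g⁻¹ • DomMulAct.mk h⁻¹ • f
        rw [smul_smul, ← DomMulAct.mk_mul, mul_inv_rev] }
  refine ⟨π, (injective_iff_map_eq_one π).2 fun g hg ↦ ?_, fun v ↦ ?_⟩
  · by_contra hne
    -- translation by `g` would fix a continuous function that separates `1` from `g`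
    obtain ⟨f, hf0, hf1, -⟩ := exists_continuous_zero_one_of_isClosed
      (isClosed_singleton (x := (1 : G))) (isClosed_singleton (x := g))
      (Set.disjoint_singleton.2 (Ne.symm hne))
    have hmem : MemLp f 2 μ := by
      exact f.continuous.memLp_of_hasCompactSupport (HasCompactSupport.of_compactSpace f)
    have h : DomMulAct.mk g⁻¹ • hmem.toLp f = hmem.toLp f :=
      congrArg (fun e : Lp ℝ 2 μ ≃ₗᵢ[ℝ] Lp ℝ 2 μ ↦ e (hmem.toLp f)) hg
    rw [DomMulAct.mk_smul_toLp, MemLp.toLp_eq_toLp_iff] at h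
    have h' := (Continuous.ae_eq_iff_eq μ (by fun_prop) f.continuous).1 h
    have := congrFun h' g
    simp only [smul_eq_mul, inv_mul_cancel] at this
    rw [hf0 rfl, hf1 rfl] at this
    exact zero_ne_one this
  · change Continuous fun g : G ↦ DomMulAct.mk g⁻¹ • v
    have hc : Continuous fun g : G ↦ DomMulAct.mk g⁻¹ :=
      DomMulAct.continuous_mk.comp continuous_inv
    have : Fact ((2 : ENNReal) ≠ ⊤) := ⟨ENNReal.ofNat_ne_top⟩
    exact hc.smul continuous_const

/-! ### Hunt's variational argument -/

section OneParameter

variable {A : Type*} [NormedRing A] [NormedAlgebra ℝ A]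

open MeasureTheory intervalIntegral in
/-- A continuous one-parameter family in a Banach algebra is differentiable. -/
theorem exists_hasDerivAt_of_continuous_of_map_add [CompleteSpace A] {u : ℝ → A}
    (hu : Continuous u) (h0 : u 0 = 1) (hadd : ∀ s t, u (s + t) = u s * u t) :
    ∃ X, HasDerivAt u X 0 := by
  let J : ℝ → A := fun s ↦ ∫ r in (0 : ℝ)..s, u r
  have hJ : ∀ s, HasDerivAt J (u s) s := fun s ↦
    integral_hasDerivAt_right (hu.intervalIntegrable _ _)
      hu.stronglyMeasurable.stronglyMeasurableAtFilter hu.continuousAt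
  -- `J s / s → u 0 = 1` as `s → 0`, so `J s` is invertible for some small `s`
  obtain ⟨s, hs⟩ : ∃ s, IsUnit (J s) := by
    have hlim := (hasDerivAt_iff_tendsto_slope_zero.1 (hJ 0))
    have hJ0 : J 0 = 0 := integral_same
    simp only [zero_add, hJ0, sub_zero, h0] at hlim
    have hev := hlim.eventually (Units.isOpen.mem_nhds isUnit_one)
    obtain ⟨s, hs, hs0⟩ := (hev.and self_mem_nhdsWithin).exists
    have : J s = algebraMap ℝ A s * (s⁻¹ • J s) := by
      rw [← Algebra.smul_def, smul_inv_smul₀ hs0]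
    exact ⟨s, this ▸ ((IsUnit.mk0 s hs0).map (algebraMap ℝ A)).mul hs⟩
  obtain ⟨U, hU⟩ := hs
  have hmul : ∀ t, u t * J s = J (t + s) - J t := fun t ↦ by
    have h1 : u t * J s = ∫ r in (0 : ℝ)..s, u (t + r) := by
      simp only [hadd, J]
      exact ((ContinuousLinearMap.mul ℝ A (u t)).intervalIntegral_comp_comm
        (hu.intervalIntegrable _ _)).symm
    rw [h1, integral_comp_add_left, add_zero]
    exact (integral_interval_sub_left (hu.intervalIntegrable _ _)
      (hu.intervalIntegrable _ _)).symm
  have hueq : u = fun t ↦ (J (t + s) - J t) * ((U⁻¹ : Aˣ) : A) := funext fun t ↦ by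
    rw [← hmul, ← hU, Units.mul_inv_cancel_right]
  rw [hueq]
  exact ⟨_, ((HasDerivAt.comp_add_const 0 s (hJ (0 + s))).sub (hJ 0)).mul_const _⟩

variable {u v : ℝ → A} {X Y : A}

theorem commute_of_hasDerivAt_of_forall_commute {M : A} (hv : HasDerivAt v Y 0)
    (h : ∀ t, Commute (v t) M) : Commute Y M := by
  have h1 : HasDerivAt (fun t ↦ v t * M) (Y * M) 0 := hv.mul_const M
  have h2 : HasDerivAt (fun t ↦ v t * M) (M * Y) 0 := by
    simp only [fun t ↦ (h t).eq]
    exact hv.const_mul M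
  exact h1.unique h2

theorem HasDerivAt.comp_neg_zero {f : ℝ → A} {f' : A} (hf : HasDerivAt f f' 0) :
    HasDerivAt (fun t ↦ f (-t)) (-f') 0 := by
  have h : HasDerivAt f f' (-0) := by rwa [neg_zero]
  have h' := h.scomp 0 (hasDerivAt_neg 0)
  rw [neg_one_smul] at h'
  exact h'

theorem hasDerivAt_conj {M : A} (h0 : v 0 = 1) (hv : HasDerivAt v Y 0) :
    HasDerivAt (fun t ↦ v t * M * v (-t)) (Y * M - M * Y) 0 := by
  have h := (hv.mul_const M).mul hv.comp_neg_zero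
  simp only [neg_zero, h0, one_mul, mul_one, mul_neg, ← sub_eq_add_neg] at h
  exact h

/-- A one-parameter family commutes with everything that its generator commutes with. -/
theorem commute_of_hasDerivAt_of_commute {M : A} (h0 : v 0 = 1)
    (hadd : ∀ s t, v (s + t) = v s * v t) (hv : HasDerivAt v Y 0) (h : Commute Y M) (t : ℝ) :
    Commute (v t) M := by
  let f : ℝ → A := fun t ↦ v t * M * v (-t)
  have hf : ∀ s, HasDerivAt f 0 s := fun s ↦ by
    have h1 : HasDerivAt f 0 0 := by
      have := hasDerivAt_conj (M := M) h0 hv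
      rwa [h.eq, sub_self] at this
    have h2 : f = fun r ↦ v s * f (r - s) * v (-s) := funext fun r ↦ by
      have e1 : v r = v s * v (r - s) := by rw [← hadd, add_sub_cancel]
      have e2 : v (-r) = v (-(r - s)) * v (-s) := by rw [← hadd]; congr 1; ring
      simp only [f, e1, e2, mul_assoc]
    rw [h2]
    have h3 : HasDerivAt (fun r ↦ f (r - s)) 0 s :=
      HasDerivAt.comp_sub_const s s (by rwa [sub_self])
    simpa using (h3.const_mul (v s)).mul_const (v (-s))
  have hconst : f t = f 0 :=
    is_const_of_deriv_eq_zero (fun s ↦ (hf s).differentiableAt) (fun s ↦ (hf s).deriv) t 0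
  simp only [f, neg_zero, h0, one_mul, mul_one] at hconst
  rw [Commute, SemiconjBy]
  calc v t * M = v t * M * (v (-t) * v t) := by rw [← hadd, neg_add_cancel, h0, mul_one]
    _ = M * v t := by rw [← mul_assoc, hconst]

/-- Hunt's variational argument, for a trace form `τ`. If moving `X` by conjugation with the
products `u a * v b` does not increase `τ (X * Y)`, then `[X, Y]` is isotropic. -/
theorem trace_commutator_sq_eq_zero (τ : A →L[ℝ] ℝ) (hτ : ∀ a b, τ (a * b) = τ (b * a))
    (hu0 : u 0 = 1) (hu : HasDerivAt u X 0)
    (hv0 : v 0 = 1) (hvadd : ∀ s t, v (s + t) = v s * v t) (hv : HasDerivAt v Y 0)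
    (hmax : ∀ a b, τ (u a * v b * X * (v (-b) * u (-a)) * Y) ≤ τ (X * Y)) :
    τ ((X * Y - Y * X) * (X * Y - Y * X)) = 0 := by
  have hvY : ∀ b, Commute Y (v b) := fun b ↦
    commute_of_hasDerivAt_of_forall_commute hv fun t ↦ by
      rw [Commute, SemiconjBy, ← hvadd, ← hvadd, add_comm]
  have hu' : HasDerivAt (fun a ↦ u (-a) * Y * u a) (-(X * Y - Y * X)) 0 := by
    simpa only [neg_neg] using (hasDerivAt_conj (M := Y) hu0 hu).comp_neg_zero
  -- for fixed `b` the value at `a = 0` is the maximum, so the derivative in `a` vanishes there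
  have hcrit : ∀ b, τ (v b * X * v (-b) * (-(X * Y - Y * X))) = 0 := fun b ↦ by
    have hd : HasDerivAt (fun a ↦ τ (v b * X * v (-b) * (u (-a) * Y * u a)))
        (τ (v b * X * v (-b) * (-(X * Y - Y * X)))) 0 :=
      τ.hasFDerivAt.comp_hasDerivAt 0 (hu'.const_mul _)
    refine IsLocalMax.hasDerivAt_eq_zero (Filter.Eventually.of_forall fun a ↦ ?_) hd
    have e0 : τ (v b * X * v (-b) * (u (-0) * Y * u 0)) = τ (X * Y) := by
      rw [neg_zero, hu0, one_mul, mul_one, mul_assoc, ← (hvY (-b)).eq, mul_assoc, hτ, mul_assoc,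
        mul_assoc, ← hvadd, neg_add_cancel, hv0, mul_one]
    rw [e0]
    refine le_trans (le_of_eq ?_) (hmax a b)
    rw [← mul_assoc, hτ]
    congr 1
    simp only [mul_assoc]
  have hd : HasDerivAt (fun b ↦ τ (v b * X * v (-b) * (-(X * Y - Y * X))))
      (τ ((Y * X - X * Y) * (-(X * Y - Y * X)))) 0 :=
    τ.hasFDerivAt.comp_hasDerivAt 0 ((hasDerivAt_conj hv0 hv).mul_const _)
  simp only [hcrit] at hd
  rw [← hd.unique (hasDerivAt_const 0 0)]
  congr 1
  rw [← neg_sub (X * Y) (Y * X), neg_mul_neg]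

end OneParameter

section Orthogonal

variable {V : Type*} [NormedAddCommGroup V] [InnerProductSpace ℝ V]

/-- The generator of a one-parameter family of isometries is skew-symmetric. -/
theorem inner_generator_left {u : ℝ → V →L[ℝ] V} {X : V →L[ℝ] V} (hu0 : u 0 = 1)
    (hu : HasDerivAt u X 0) (hiso : ∀ s v w, inner ℝ (u s v) (u s w) = inner ℝ v w) (v w : V) :
    inner ℝ (X v) w = -inner ℝ v (X w) := by
  have hd : ∀ v, HasDerivAt (fun s ↦ u s v) (X v) 0 := fun v ↦
    (ContinuousLinearMap.apply ℝ V v).hasFDerivAt.comp_hasDerivAt 0 hu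
  have h := (hd v).inner ℝ (hd w)
  simp only [hiso] at h
  have := h.unique (hasDerivAt_const 0 _)
  simp only [hu0, one_apply_eq_self] at this
  linarith

theorem inner_commutator_left {X Y : V →L[ℝ] V}
    (hX : ∀ v w, inner ℝ (X v) w = -inner ℝ v (X w))
    (hY : ∀ v w, inner ℝ (Y v) w = -inner ℝ v (Y w)) (v w : V) :
    inner ℝ ((X * Y - Y * X) v) w = -inner ℝ v ((X * Y - Y * X) w) := by
  change inner ℝ (X (Y v) - Y (X v)) w = -inner ℝ v (X (Y w) - Y (X w))
  rw [inner_sub_left, inner_sub_right, hX, hY, hY, hX]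
  ring

variable [FiniteDimensional ℝ V]

/-- The trace as a continuous functional on the endomorphisms of a finite-dimensional space. -/
noncomputable def traceCLM (V : Type*) [NormedAddCommGroup V] [InnerProductSpace ℝ V]
    [FiniteDimensional ℝ V] : (V →L[ℝ] V) →L[ℝ] ℝ :=
  LinearMap.toContinuousLinearMap (LinearMap.trace ℝ V ∘ₗ ContinuousLinearMap.coeLM ℝ)

theorem traceCLM_mul_comm (a b : V →L[ℝ] V) : traceCLM V (a * b) = traceCLM V (b * a) :=
  LinearMap.trace_mul_comm ℝ (a : V →ₗ[ℝ] V) b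

/-- The trace form is negative definite on skew-symmetric operators. -/
theorem eq_zero_of_traceCLM_mul_self_eq_zero {W : V →L[ℝ] V}
    (hskew : ∀ v w, inner ℝ (W v) w = -inner ℝ v (W w)) (h : traceCLM V (W * W) = 0) :
    W = 0 := by
  let b := stdOrthonormalBasis ℝ V
  have h1 : traceCLM V (W * W) = -∑ i, ‖W (b i)‖ ^ 2 := by
    change LinearMap.trace ℝ V ((W * W : V →L[ℝ] V) : V →ₗ[ℝ] V) = _
    rw [LinearMap.trace_eq_sum_inner _ b, ← Finset.sum_neg_distrib]
    refine Finset.sum_congr rfl fun i _ ↦ ?_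
    change inner ℝ (b i) (W (W (b i))) = _
    rw [← real_inner_self_eq_norm_sq, hskew, neg_neg]
  rw [h1, neg_eq_zero, Finset.sum_eq_zero_iff_of_nonneg fun i _ ↦ sq_nonneg _] at h
  have h2 : ∀ i, W (b i) = 0 := fun i ↦ by simpa using h i (Finset.mem_univ i)
  ext v
  rw [← b.sum_repr v]
  simp [h2]

/-- Two one-parameter subgroups of a compact group of isometries of a finite-dimensional
space commute after a suitable conjugation. -/
theorem exists_conj_commute_of_finiteDimensional {Z : Type*} [Group Z] [TopologicalSpace Z]
    [IsTopologicalGroup Z] [CompactSpace Z] (ρ : Z →* (V →L[ℝ] V)) (hρ : Continuous ρ)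
    (hiso : ∀ z v w, inner ℝ (ρ z v) (ρ z w) = inner ℝ v w) {x y : ℝ → Z}
    (hx : Continuous x) (hxadd : ∀ s t, x (s + t) = x s * x t)
    (hy : Continuous y) (hyadd : ∀ s t, y (s + t) = y s * y t) :
    ∃ z, ∀ a b, Commute (ρ (z * x a * z⁻¹)) (ρ (y b)) := by
  have hx0 : x 0 = 1 := by simpa using hxadd 0 0
  have hy0 : y 0 = 1 := by simpa using hyadd 0 0
  have hxneg : ∀ s, x (-s) = (x s)⁻¹ := fun s ↦
    eq_inv_of_mul_eq_one_left (by rw [← hxadd, neg_add_cancel, hx0])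
  have hyneg : ∀ s, y (-s) = (y s)⁻¹ := fun s ↦
    eq_inv_of_mul_eq_one_left (by rw [← hyadd, neg_add_cancel, hy0])
  have hcomp : CompleteSpace (V →L[ℝ] V) := FiniteDimensional.complete ℝ _
  obtain ⟨X, hX⟩ := exists_hasDerivAt_of_continuous_of_map_add (hρ.comp hx) (by simp [hx0])
    fun s t ↦ by simp [hxadd]
  obtain ⟨Y, hY⟩ := exists_hasDerivAt_of_continuous_of_map_add (hρ.comp hy) (by simp [hy0])
    fun s t ↦ by simp [hyadd]
  obtain ⟨z, -, hz⟩ := isCompact_univ.exists_isMaxOn (Set.univ_nonempty (α := Z))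
    (f := fun z ↦ traceCLM V (ρ z * X * ρ z⁻¹ * Y)) (by fun_prop)
  -- conjugating by a maximizer `z`, the maximum is attained at `1`
  let u : ℝ → V →L[ℝ] V := fun a ↦ ρ (z * x a * z⁻¹)
  let v : ℝ → V →L[ℝ] V := fun b ↦ ρ (y b)
  have hu0 : u 0 = 1 := by
    simp only [u, hx0, mul_one, mul_inv_cancel, map_one]
  have hv0 : v 0 = 1 := by simp [v, hy0]
  have huadd : ∀ s t, u (s + t) = u s * u t := fun s t ↦ by
    simp only [u, hxadd, ← map_mul]; congr 1; group
  have hvadd : ∀ s t, v (s + t) = v s * v t := fun s t ↦ by simp [v, hyadd]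
  have hu : HasDerivAt u (ρ z * X * ρ z⁻¹) 0 := by
    simp only [u, map_mul]
    exact (hX.const_mul (ρ z)).mul_const (ρ z⁻¹)
  have hsq := trace_commutator_sq_eq_zero (traceCLM V) traceCLM_mul_comm hu0 hu hv0 hvadd hY
    fun a b ↦ by
      refine le_trans (le_of_eq ?_) (hz (Set.mem_univ (z * x a * z⁻¹ * y b * z)))
      simp only [u, v, hxneg, hyneg, mul_inv_rev, inv_inv, map_mul, mul_assoc]
  refine ⟨z, fun a b ↦ ?_⟩
  have huX := inner_generator_left hu0 hu fun s ↦ hiso _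
  have hvY := inner_generator_left hv0 hY fun s ↦ hiso _
  have hW := eq_zero_of_traceCLM_mul_self_eq_zero (inner_commutator_left huX hvY) hsq
  have h1 : Commute (ρ z * X * ρ z⁻¹) Y := sub_eq_zero.1 hW
  have h2 := commute_of_hasDerivAt_of_commute hu0 huadd hu h1 a
  exact (commute_of_hasDerivAt_of_commute hv0 hvadd hY h2.symm b).symm

end Orthogonal

/-! ### Conjugating one-parameter subgroups of a compact group -/

/-- The operator by which a group element acts on an invariant subspace. -/
def invariantRestrict {G H : Type*} [Group G] [NormedAddCommGroup H] [InnerProductSpace ℝ H]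
    (π : G →* (H ≃ₗᵢ[ℝ] H)) (V : Submodule ℝ H) (hV : ∀ g, ∀ v ∈ V, π g v ∈ V) :
    G →* (V →L[ℝ] V) where
  toFun g := (π g).toContinuousLinearEquiv.toContinuousLinearMap.restrict (hV g)
  map_one' := by ext v; simp
  map_mul' g h := by
    ext v
    change π (g * h) v = π g (π h v)
    rw [map_mul]; rfl

open MeasureTheory in
/-- In a compact Hausdorff group, two one-parameter subgroups commute after a suitable
conjugation. On each finite-dimensional invariant subspace of `L²` the suitable conjugators form a
nonempty closed set; these sets are directed, so they have a common point. -/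
theorem exists_conj_commute {Z : Type*} [Group Z] [TopologicalSpace Z]
    [IsTopologicalGroup Z] [CompactSpace Z] [T2Space Z] {x y : ℝ → Z}
    (hx : Continuous x) (hxadd : ∀ s t, x (s + t) = x s * x t)
    (hy : Continuous y) (hyadd : ∀ s t, y (s + t) = y s * y t) :
    ∃ z, ∀ a b, Commute (z * x a * z⁻¹) (y b) := by
  borelize Z
  let μ : Measure Z := Measure.haarMeasure ⊤
  have hμ : IsProbabilityMeasure μ := ⟨Measure.haarMeasure_self⟩
  obtain ⟨π, hinj, hπ⟩ := exists_injective_orthogonal_representation Z μ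
  let ι := {V : Submodule ℝ (Lp ℝ 2 μ) // FiniteDimensional ℝ V ∧ ∀ g, ∀ v ∈ V, π g v ∈ V}
  -- the conjugators that work on a given finite-dimensional invariant subspace
  let C : ι → Set Z := fun V ↦ {z | ∀ a b, ∀ v ∈ V.1,
    π (z * x a * z⁻¹) (π (y b) v) = π (y b) (π (z * x a * z⁻¹) v)}
  have hclosed : ∀ V, IsClosed (C V) := fun V ↦ by
    simp only [C, Set.ofPred_forall]
    refine isClosed_iInter fun a ↦ isClosed_iInter fun b ↦ isClosed_iInter fun v ↦
      isClosed_iInter fun _ ↦ ?_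
    have hc : Continuous fun z ↦ z * x a * z⁻¹ := by fun_prop
    exact isClosed_eq ((hπ _).comp hc) ((π (y b)).continuous.comp ((hπ v).comp hc))
  have hne : ∀ V, (C V).Nonempty := fun ⟨V, hfin, hV⟩ ↦ by
    obtain ⟨z, hz⟩ := exists_conj_commute_of_finiteDimensional (invariantRestrict π V hV)
      (continuous_clm_apply.2 fun v ↦ (hπ v).subtype_mk _)
      (fun z v w ↦ (π z).inner_map_map v w) hx hxadd hy hyadd
    refine ⟨z, fun a b v hv ↦ ?_⟩
    exact congrArg Subtype.val (DFunLike.congr_fun (hz a b).eq (⟨v, hv⟩ : V))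
  have hdir : Directed (· ⊇ ·) C := fun V W ↦ by
    have := V.2.1
    have := W.2.1
    refine ⟨⟨V.1 ⊔ W.1, inferInstance, fun g ↦ ?_⟩, fun z hz a b v hv ↦
      hz a b v (Submodule.mem_sup_left hv), fun z hz a b v hv ↦
      hz a b v (Submodule.mem_sup_right hv)⟩
    change V.1 ⊔ W.1 ≤ (V.1 ⊔ W.1).comap (π g).toLinearEquiv.toLinearMap
    exact sup_le (fun v hv ↦ Submodule.mem_sup_left (V.2.2 g v hv))
      fun v hv ↦ Submodule.mem_sup_right (W.2.2 g v hv)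
  have : Nonempty ι := ⟨⟨⊥, inferInstance, fun g v hv ↦ by
    rw [Submodule.mem_bot] at hv ⊢; rw [hv, map_zero]⟩⟩
  obtain ⟨z, hz⟩ := IsCompact.nonempty_iInter_of_directed_nonempty_isCompact_isClosed C hdir hne
    (fun V ↦ (hclosed V).isCompact) hclosed
  refine ⟨z, fun a b ↦ hinj ?_⟩
  let F : Lp ℝ 2 μ →L[ℝ] Lp ℝ 2 μ :=
    (π (z * x a * z⁻¹ * y b)).toContinuousLinearEquiv.toContinuousLinearMap -
      (π (y b * (z * x a * z⁻¹))).toContinuousLinearEquiv.toContinuousLinearMap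
  have hF (v) : F v = π (z * x a * z⁻¹) (π (y b) v) - π (y b) (π (z * x a * z⁻¹) v) := by
    simp only [F, map_mul]; rfl
  have hker : (⊤ : Submodule ℝ (Lp ℝ 2 μ)) ≤ F.ker := by
    rw [← topologicalClosure_finiteDimensionalPart (μ := μ) hπ]
    refine Submodule.topologicalClosure_minimal _ (sSup_le fun V hV v hv ↦ ?_) F.isClosed_ker
    rw [LinearMap.mem_ker]
    exact (hF v).trans (sub_eq_zero.2 (Set.mem_iInter.1 hz ⟨V, hV⟩ a b v hv))
  ext1 v
  exact sub_eq_zero.1 (hker (Submodule.mem_top : v ∈ _))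


/-! ### Maximal tori and their normalizers -/

section MaximalTorus

variable {G : Type*} [Group G] [TopologicalSpace G]

theorem IsTorus.commute {T : Subgroup G} (hT : IsTorus T) {s t : G} (hs : s ∈ T) (ht : t ∈ T) :
    Commute s t := by
  obtain ⟨k, ⟨e⟩⟩ := hT
  have : (⟨s, hs⟩ * ⟨t, ht⟩ : T) = ⟨t, ht⟩ * ⟨s, hs⟩ := e.injective (by
    rw [map_mul, map_mul, mul_comm])
  exact congrArg Subtype.val this

theorem IsTorus.exists_denseRange {T : Subgroup G} (hT : IsTorus T) :
    ∃ x : ℝ → T, Continuous x ∧ (∀ s t, x (s + t) = x s * x t) ∧ DenseRange x := by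
  obtain ⟨k, ⟨e⟩⟩ := hT
  obtain ⟨α, hα⟩ := exists_denseRange_oneParameter k
  refine ⟨fun s ↦ e.symm (torusCover k (s • α)), ?_, fun s t ↦ ?_, ?_⟩
  · exact e.symm.continuous.comp ((continuous_torusCover k).comp (by fun_prop))
  · simp only [add_smul, torusCover_add, map_mul]
  · exact e.symm.surjective.denseRange.comp hα e.symm.continuous

variable [IsTopologicalGroup G]

theorem IsTorus.map_conj {T : Subgroup G} (hT : IsTorus T) (g : G) :
    IsTorus (T.map (MulAut.conj g).toMonoidHom) := by
  obtain ⟨k, ⟨e⟩⟩ := hT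
  let E : T ≃* T.map (MulAut.conj g).toMonoidHom :=
    T.equivMapOfInjective _ (MulAut.conj g).injective
  have hE : ∀ t : T, (E t : G) = g * t * g⁻¹ := fun t ↦ rfl
  have hEs : ∀ t, (E.symm t : G) = g⁻¹ * t * g := fun t ↦ by
    obtain ⟨s, rfl⟩ := E.surjective t
    rw [E.symm_apply_apply, hE]; group
  refine ⟨k, ⟨ContinuousMulEquiv.trans { E.symm with
    continuous_toFun := ?_
    continuous_invFun := ?_ } e⟩⟩
  · refine continuous_induced_rng.2 ?_
    exact Continuous.congr (by fun_prop) fun t ↦ (hEs t).symm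
  · refine continuous_induced_rng.2 ?_
    exact Continuous.congr (by fun_prop) fun t ↦ (hE t).symm

theorem IsMaximalTorus.map_conj {T : Subgroup G} (hT : IsMaximalTorus T) (g : G) :
    IsMaximalTorus (T.map (MulAut.conj g).toMonoidHom) := by
  refine ⟨hT.1.map_conj g, fun P hP hle ↦ ?_⟩
  have h := hT.2 (hP.map_conj g⁻¹) fun t ht ↦
    ⟨g * t * g⁻¹, hle ⟨t, ht, rfl⟩, by simp [mul_assoc]⟩
  exact fun p hp ↦ ⟨g⁻¹ * p * g, h ⟨p, hp, by simp⟩, by simp [mul_assoc]⟩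

/-- Two commuting maximal tori coincide. -/
theorem IsMaximalTorus.eq_of_commute [T2Space G] {S T : Subgroup G} (hS : IsMaximalTorus S)
    (hT : IsMaximalTorus T) (hST : ∀ s ∈ S, ∀ t ∈ T, Commute s t) : S = T := by
  obtain ⟨P, hP, hSP, hTP⟩ := hS.1.exists_isTorus_ge_of_commute hT.1 hST
  exact (hSP.antisymm (hS.2 hP hSP)).trans (hTP.antisymm (hT.2 hP hTP)).symm

/-- A maximal torus `T` and its conjugate `g⁻¹ T g` are conjugate in every closed subgroup that
contains both. -/
theorem IsMaximalTorus.exists_conj_eq [CompactSpace G] [T2Space G] {T : Subgroup G}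
    (hT : IsMaximalTorus T) (Z : Subgroup G) (hZ : IsClosed (Z : Set G)) (g : G)
    (hTZ : T ≤ Z) (hgTZ : ∀ t ∈ T, g⁻¹ * t * g ∈ Z) :
    ∃ z ∈ Z, T.map (MulAut.conj z).toMonoidHom = T.map (MulAut.conj g⁻¹).toMonoidHom := by
  have : CompactSpace Z := isCompact_iff_compactSpace.1 hZ.isCompact
  obtain ⟨x, hx, hxadd, hxd⟩ := hT.1.exists_denseRange
  obtain ⟨z, hz⟩ := exists_conj_commute (Z := Z) (x := fun s ↦ ⟨x s, hTZ (x s).2⟩)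
    (y := fun s ↦ ⟨g⁻¹ * x s * g, hgTZ _ (x s).2⟩)
    (by fun_prop) (fun s t ↦ Subtype.ext (by simp [hxadd]))
    (by fun_prop) (fun s t ↦ Subtype.ext (by simp [hxadd, mul_assoc]))
  -- commutation on the dense one-parameter subgroups extends to the tori, one factor at a time
  have h1 (a : ℝ) (q : T) : Commute (z * x a * z⁻¹ : G) (g⁻¹ * q * g) :=
    hxd.induction_on q (isClosed_eq (by fun_prop) (by fun_prop))
      fun b ↦ congrArg Subtype.val (hz a b).eq
  have h2 (p q : T) : Commute (z * p * z⁻¹ : G) (g⁻¹ * q * g) :=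
    hxd.induction_on p (isClosed_eq (by fun_prop) (by fun_prop)) fun a ↦ h1 a q
  refine ⟨z, z.2, (hT.map_conj _).eq_of_commute (hT.map_conj _) ?_⟩
  rintro _ ⟨p, hp, rfl⟩ _ ⟨q, hq, rfl⟩
  simpa using h2 ⟨p, hp⟩ ⟨q, hq⟩

/-- Fusion of tuples in a maximal torus of a compact group is controlled by its normalizer.
The centralizer of `t` contains both `T` and `g⁻¹ T g`; if `z` in it conjugates the first to the
second, then `g * z` normalizes `T` and acts on `t` as `g` does. -/
theorem IsMaximalTorus.exists_mem_normalizer_conjTuple_eq [CompactSpace G] [T2Space G]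
    {T : Subgroup G} (hT : IsMaximalTorus T) {n : ℕ} {t : Fin n → G} (ht : t ∈ tuplesIn n T)
    (g : G) (hgt : conjTuple g t ∈ tuplesIn n T) :
    ∃ g' ∈ Subgroup.normalizer (T : Set G), conjTuple g' t = conjTuple g t := by
  let Z := Subgroup.centralizer (Set.range t)
  have hTZ : T ≤ Z := fun s hs ↦ by
    rw [Subgroup.mem_centralizer_iff]
    rintro _ ⟨i, rfl⟩
    exact (hT.1.commute (ht i) hs).eq
  have hgTZ : ∀ s ∈ T, g⁻¹ * s * g ∈ Z := fun s hs ↦ by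
    rw [Subgroup.mem_centralizer_iff]
    rintro _ ⟨i, rfl⟩
    have h : g * t i * g⁻¹ * s = s * (g * t i * g⁻¹) := (hT.1.commute (hgt i) hs).eq
    calc t i * (g⁻¹ * s * g) = g⁻¹ * (g * t i * g⁻¹ * s) * g := by group
      _ = g⁻¹ * s * g * t i := by rw [h]; group
  obtain ⟨z, hz, hzT⟩ := hT.exists_conj_eq Z (Set.isClosed_centralizer _) g hTZ hgTZ
  refine ⟨g * z, ?_, funext fun i ↦ ?_⟩
  · have h1 := congrArg (Subgroup.map (MulAut.conj g).toMonoidHom) hzT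
    rw [Subgroup.map_map, Subgroup.map_map] at h1
    rw [Subgroup.mem_normalizer_iff_map_conj_eq]
    convert h1 using 1
    · congr 1
      ext s
      simp
    · convert (Subgroup.map_id T).symm using 2
      ext s
      simp [mul_assoc]
  · have h : t i * z = z * t i := Subgroup.mem_centralizer_iff.1 hz _ ⟨i, rfl⟩
    simp only [conjTuple, mul_inv_rev]
    calc g * z * t i * (z⁻¹ * g⁻¹) = g * (z * t i) * z⁻¹ * g⁻¹ := by group
      _ = g * t i * g⁻¹ := by rw [← h]; group

end MaximalTorus

theorem mainTheorem2 {E : Type*} [NormedAddCommGroup E] [NormedSpace ℝ E] [FiniteDimensional ℝ E]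
    {G : Type*} [Group G] [TopologicalSpace G] [ChartedSpace E G] [LieGroup 𝓘(ℝ, E) ∞ G]
    [CompactSpace G] [T2Space G]
    (T : Subgroup G) (hT : IsMaximalTorus T)
    (n : ℕ) (t : Fin n → G) (ht : t ∈ tuplesIn n T) :
    conjOrbit ⊤ t ∩ tuplesIn n T = conjOrbit (Subgroup.normalizer (T : Set G)) t ∧
    ∀ (g : G) (t' : Fin n → G), t' ∈ tuplesIn n T → conjTuple g t = t' →
      ∃ g' ∈ Subgroup.normalizer (T : Set G), conjTuple g' t = t' := by
  have : IsTopologicalGroup G := topologicalGroup_of_lieGroup 𝓘(ℝ, E) ∞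
  have key : ∀ (g : G) (t' : Fin n → G), t' ∈ tuplesIn n T → conjTuple g t = t' →
      ∃ g' ∈ Subgroup.normalizer (T : Set G), conjTuple g' t = t' := by
    rintro g _ hgt rfl
    exact hT.exists_mem_normalizer_conjTuple_eq ht g hgt
  refine ⟨Set.ext fun t' ↦ ⟨?_, ?_⟩, key⟩
  · rintro ⟨⟨g, -, hg⟩, ht'⟩
    exact key g t' ht' hg
  · rintro ⟨g, hg, rfl⟩
    exact ⟨⟨g, Subgroup.mem_top g, rfl⟩, fun i ↦ (Subgroup.mem_normalizer_iff.1 hg (t i)).1 (ht i)⟩
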